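/- Let $Q$ be a finite-dimensional smooth manifold (without boundary), let $\tau_Q:TQ\to Q$ and $\pi_Q:T^*Q\to Q$ be the canonical projections, and let $L:TQ\to\mathbb R$ be a smooth function. Let $S$ be the vertical endomorphism and $\Delta$ the Liouville vector field of $TQ$, and put $\alpha_L=S^*(dL)$, $\omega_L=-d\alpha_L$ and $E_L=\Delta(L)-L$. Let $FL:TQ\to T^*Q$ be the Legendre transformation (the fibre derivative of $L$), and let $\omega_Q=-d\theta_Q=dq^A\wedge dp_A$ be the canonical symplectic form of $T^*Q$. Assume that $L$ is almost regular: $M_1=FL(TQ)$ is an embedded submanifold of $T^*Q$, with inclusion $j_1$, and the induced map $FL_1:TQ\to M_1$ is a submersion with connected fibres. Put $\omega_1=j_1^*\omega_Q$, and let $h_1:M_1\to\mathbb R$ be the function with $h_1\circ FL_1=E_L$. Apply the constraint algorithm to $(TQ,\omega_L,dE_L)$ and to $(M_1,\omega_1,dh_1)$, that is, put $P_1=TQ$ and, for $l\ge 1$, $$P_{l+1}=\{p\in P_l : \exists\, v\in T_pP_l,\ i_v\omega_L=dE_L(p) \text{ on } T_p(TQ)\},$$ $$M_{l+1}=\{q\in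 M_l : \exists\, v\in T_qM_l,\ i_v\omega_1=dh_1(q)\text{ on } T_qM_1\}.$$ Assume that all $P_l$ and all $M_l$ are submanifolds, of $TQ$ and of $M_1$ respectively, and that $P_{k+1}=P_k$ for some $k\geq 1$. Then $M_{k+1}=M_k$ and $FL(P_k)=M_k$. Write $P_f=P_k$, $M_f=M_k$ and $FL_f=FL|_{P_f}:P_f\to M_f$. A smooth vector field $\xi$ on $P_f$ projects on a smooth vector field $X$ on $M_f$ if $TFL_f\circ\xi=X\circ FL_f$, and $\xi$ is $FL_f$-projectable if it projects on some such $X$, denoted by $TFL_f(\xi)$. Then: 1. If a vector field $\xi$ on $P_f$ is $FL_f$-projectable and satisfies $i_\xi\omega_L=dE_L$ at all points of $P_f$ (as linear forms on $T_p(TQ)$), then its projection $X=TFL_f(\xi)$ satisfies $i_X\omega_1=dh_1$ at all points of $M_f$ (as linear forms on $T_qM_1$). 2. Conversely, if a vector field $X$ on $M_f$ satisfies $i_X\omega_1=dh_1$ at all points of $M_f$, then every $FL_f$-projectable vector field $\xi$ on $P_f$ which projects on $X$ satisfies $i_\xi\omega_L=dE_L$ at all points of $P_f$. -/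

import Mathlib

open Set Filter Topology Bundle Manifold
open scoped ContDiff

noncomputable section

namespace SingularLagrangian

/-! ### Presymplectic systems and the constraint algorithm on a manifold without boundary -/

section General

variable {F : Type*} [NormedAddCommGroup F] [NormedSpace ℝ F]
  {H : Type*} [TopologicalSpace H] (I : ModelWithCorners ℝ F H)
  {M : Type*} [TopologicalSpace M] [ChartedSpace H M]

/-- (Not necessarily smooth) differential 1-forms on `M`. -/
abbrev OneForm : Type _ := ∀ x : M, TangentSpace I x →L[ℝ] ℝ

/-- (Not necessarily smooth) fields of bilinear forms on `M`; 2-forms are considered as such. -/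
abbrev TwoForm : Type _ := ∀ x : M, TangentSpace I x →L[ℝ] TangentSpace I x →L[ℝ] ℝ

variable {I}

/-- The differential of a function, `(dg)_x(v) = T_x g (v)`. -/
def differential (g : M → ℝ) : OneForm I (M := M) := fun x => mfderiv I 𝓘(ℝ, ℝ) g x

/-- The local representative of a 1-form `α` in the preferred chart `φ` at `x`, that is the 1-form
`(φ⁻¹)^* α` on the model vector space. -/
def localRep (α : OneForm I (M := M)) (x : M) : F → F →L[ℝ] ℝ := fun y =>
  (α ((extChartAt I x).symm y)).comp (mfderiv 𝓘(ℝ, F) I (extChartAt I x).symm y)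

/-- The exterior derivative of a 1-form on a manifold without boundary, computed at `x` in the
preferred chart at `x`: `dα(u, v) = ∂_u (α(v)) - ∂_v (α(u))` for `u`, `v` constant in the chart.
The tangent space at `x` is identified with the model vector space by means of that same chart. -/
def extDer (α : OneForm I (M := M)) : TwoForm I (M := M) := fun x =>
  let D : F →L[ℝ] F →L[ℝ] ℝ := fderiv ℝ (localRep α x) (extChartAt I x x)
  (D - D.flip : F →L[ℝ] F →L[ℝ] ℝ)

variable (I)

/-- `S` is an (embedded) smooth submanifold of `M`: around each of its points there is a chart of
`M` in which `S` is the trace of a vector subspace. -/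
def IsSubmanifold (S : Set M) : Prop :=
  ∀ p ∈ S, ∃ φ ∈ IsManifold.maximalAtlas I ∞ M, p ∈ φ.source ∧
    ∃ W : Submodule ℝ F, ∀ x ∈ φ.source, (x ∈ S ↔ φ.extend I x ∈ W)

/-- The tangent bundle `TS`, as a subset of `TM`, of a submanifold `S` of `M`: the velocities at
time `0` of the smooth curves of `M` which are contained in `S`. -/
def tangentSet (S : Set M) : Set (TangentBundle I M) :=
  {w | ∃ c : ℝ → M, ContMDiffAt 𝓘(ℝ, ℝ) I ∞ c 0 ∧ (∀ᶠ t in 𝓝 (0 : ℝ), c t ∈ S) ∧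
    tangentMap 𝓘(ℝ, ℝ) I c (⟨0, (1 : ℝ)⟩ : TangentBundle 𝓘(ℝ, ℝ) ℝ) = w}

variable {I}

/-- The subsets produced by the constraint algorithm for the presymplectic system `(M, Ω, α)` and
the equation `i_X Ω = α`.  The whole of `M` has index `0`, and the next subset consists of
those points `p` of the previous one `S` at which there is `v ∈ T_p S` such that `i_v Ω = α`
(an equality of linear forms on `T_p M`). -/
def constraintSet (Ω : TwoForm I (M := M)) (α : OneForm I (M := M)) : ℕ → Set M
  | 0 => univ
  | l + 1 => {p ∈ constraintSet Ω α l |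
      ∃ v : TangentSpace I p,
        (⟨p, v⟩ : TangentBundle I M) ∈ tangentSet I (constraintSet Ω α l) ∧ Ω p v = α p}

/-- `ξ` is a smooth vector field on the submanifold `S`; its values outside `S` are irrelevant. -/
def IsVectorFieldOn [IsManifold I 1 M] (S : Set M) (ξ : ∀ x : M, TangentSpace I x) : Prop :=
  ContMDiffOn I I.tangent ∞ (fun x => (⟨x, ξ x⟩ : TangentBundle I M)) S ∧
    ∀ x ∈ S, (⟨x, ξ x⟩ : TangentBundle I M) ∈ tangentSet I S

/-- `i_ξ Ω = α` at the points of `S`, as linear forms on the tangent spaces of `M`. -/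
def IsSolutionOn (Ω : TwoForm I (M := M)) (α : OneForm I (M := M)) (S : Set M)
    (ξ : ∀ x : M, TangentSpace I x) : Prop :=
  ∀ x ∈ S, Ω x (ξ x) = α x

variable {F' : Type*} [NormedAddCommGroup F'] [NormedSpace ℝ F']
  {H' : Type*} [TopologicalSpace H'] {J : ModelWithCorners ℝ F' H'}
  {N : Type*} [TopologicalSpace N] [ChartedSpace H' N]

/-- The pull-back `f^* Ω`. -/
def pullback (f : M → N) (Ω : TwoForm J (M := N)) : TwoForm I (M := M) := fun x =>
  let B : F' →L[ℝ] F' →L[ℝ] ℝ := Ω (f x)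
  let A : F →L[ℝ] F' := mfderiv I J f x
  (B.bilinearComp A A : F →L[ℝ] F →L[ℝ] ℝ)

/-- The vector field `ξ` on `S` projects on `X` by means of `f`: `Tf ∘ ξ = X ∘ f` on `S`. -/
def ProjectsOn (f : M → N) (S : Set M) (ξ : ∀ x : M, TangentSpace I x)
    (X : ∀ y : N, TangentSpace J y) : Prop :=
  ∀ x ∈ S, mfderiv I J f x (ξ x) = X (f x)

end General

/-! ### Lagrangian systems on the tangent bundle of the configuration manifold `Q` -/

section Lagrangian

variable {E : Type*} [NormedAddCommGroup E] [NormedSpace ℝ E]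
  {Q : Type*} [TopologicalSpace Q] [ChartedSpace E Q] [IsManifold 𝓘(ℝ, E) ∞ Q]

variable (E Q) in
/-- The tangent bundle `TQ`. -/
abbrev TQ : Type _ := TangentBundle 𝓘(ℝ, E) Q

variable (E Q) in
/-- The cotangent bundle `T^*Q`. -/
abbrev CTQ : Type _ :=
  TotalSpace (E →L[ℝ] ℝ) (fun q : Q => TangentSpace 𝓘(ℝ, E) q →L[ℝ] Trivial Q ℝ q)

variable (E) in
/-- The model with corners of `T^*Q`. -/
abbrev cotangentModel : ModelWithCorners ℝ (E × (E →L[ℝ] ℝ)) (ModelProd E (E →L[ℝ] ℝ)) :=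
  𝓘(ℝ, E).prod 𝓘(ℝ, E →L[ℝ] ℝ)

/-- The vertical lift `T_q Q → T_v (TQ)` at `v ∈ T_q Q`, that is the derivative at `v` of the
inclusion of the fibre `T_q Q` in `TQ`; `u` is sent to the velocity at `t = 0` of `v + t u`. -/
def vlift (v : TQ E Q) : TangentSpace 𝓘(ℝ, E) v.proj →L[ℝ] TangentSpace 𝓘(ℝ, E).tangent v :=
  mfderiv 𝓘(ℝ, E) 𝓘(ℝ, E).tangent (fun w : E => (⟨v.proj, w⟩ : TQ E Q)) v.2

/-- The vertical endomorphism `S = dq^A ⊗ ∂/∂q̇^A` of `T(TQ)`. -/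
def vertEndo (v : TQ E Q) :
    TangentSpace 𝓘(ℝ, E).tangent v →L[ℝ] TangentSpace 𝓘(ℝ, E).tangent v :=
  (vlift v).comp (mfderiv 𝓘(ℝ, E).tangent 𝓘(ℝ, E) (fun w : TQ E Q => w.proj) v)

/-- The Liouville vector field `Δ = q̇^A ∂/∂q̇^A` on `TQ`. -/
def liouvilleField (v : TQ E Q) : TangentSpace 𝓘(ℝ, E).tangent v := vlift v v.2

/-- The 1-form `α_L = S^*(dL)`. -/
def alphaL (L : TQ E Q → ℝ) : OneForm 𝓘(ℝ, E).tangent (M := TQ E Q) := fun v =>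
  (differential (I := 𝓘(ℝ, E).tangent) L v).comp (vertEndo v)

/-- The Poincaré-Cartan 2-form `ω_L = -dα_L`. -/
def omegaL (L : TQ E Q → ℝ) : TwoForm 𝓘(ℝ, E).tangent (M := TQ E Q) := fun v =>
  -(extDer (alphaL L) v)

/-- The energy `E_L = Δ(L) - L`. -/
def energy (L : TQ E Q → ℝ) : TQ E Q → ℝ := fun v =>
  differential (I := 𝓘(ℝ, E).tangent) L v (liouvilleField v) - L v

/-- The Legendre transformation `FL : TQ → T^*Q`, the fibre derivative of `L`. -/
def legendre (L : TQ E Q → ℝ) : TQ E Q → CTQ E Q := fun v =>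
  ⟨v.proj, (differential (I := 𝓘(ℝ, E).tangent) L v).comp (vlift v)⟩

/-- `⟨FL(v), T τ_Q(w)⟩ = α_L(v)(w)` for `w ∈ T_v(TQ)`. -/
theorem legendre_apply (L : TQ E Q → ℝ) (v : TQ E Q) (w : TangentSpace 𝓘(ℝ, E).tangent v) :
    (legendre L v).2 (mfderiv 𝓘(ℝ, E).tangent 𝓘(ℝ, E) (fun w : TQ E Q => w.proj) v w)
      = alphaL L v w := rfl

/-- The Liouville 1-form `θ_Q = p_A dq^A` of `T^*Q`: `θ_Q(p)(w) = ⟨p, T π_Q(w)⟩`. -/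
def thetaQ : OneForm (cotangentModel E) (M := CTQ E Q) := fun p =>
  ContinuousLinearMap.comp (p.2 : TangentSpace 𝓘(ℝ, E) p.proj →L[ℝ] ℝ)
    (mfderiv (cotangentModel E) 𝓘(ℝ, E) (fun p : CTQ E Q => p.proj) p)

/-- The canonical symplectic form `ω_Q = -dθ_Q = dq^A ∧ dp_A` of `T^*Q`. -/
def omegaQ : TwoForm (cotangentModel E) (M := CTQ E Q) := fun p => -(extDer thetaQ p)

/-- The set of primary constraints `M₁ = FL(TQ)`. -/
abbrev M₁ (L : TQ E Q → ℝ) : Type _ := ↥(range (legendre L))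

/-- The inclusion `j₁ : M₁ → T^*Q`. -/
def j₁ (L : TQ E Q → ℝ) : M₁ L → CTQ E Q := Subtype.val

/-- The map `FL₁ : TQ → M₁` induced by the Legendre transformation. -/
def FL₁ (L : TQ E Q → ℝ) : TQ E Q → M₁ L := rangeFactorization (legendre L)

/-- The function `h₁` on `M₁`: the value at `q` of the energy at some point of the fibre of `FL₁`
over `q` (for an almost regular Lagrangian the choice is immaterial, and `h₁ ∘ FL₁ = E_L`). -/
def h₁ (L : TQ E Q → ℝ) : M₁ L → ℝ := fun q => energy L (Classical.choose q.2)

variable {E₁ : Type*} [NormedAddCommGroup E₁] [NormedSpace ℝ E₁]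

/-- `L` is almost regular: `M₁ = FL(TQ)`, with the given manifold structure, is a submanifold of
`T^*Q`, and `FL₁ : TQ → M₁` is a submersion with connected fibres. -/
structure IsAlmostRegular (L : TQ E Q → ℝ) [ChartedSpace E₁ (M₁ L)] : Prop where
  isSmoothEmbedding : IsSmoothEmbedding 𝓘(ℝ, E₁) (cotangentModel E) ∞ (j₁ L)
  isSubmersion : IsSubmersion 𝓘(ℝ, E).tangent 𝓘(ℝ, E₁) ∞ (FL₁ L)
  isConnected_fiber : ∀ q : M₁ L, IsConnected (FL₁ L ⁻¹' {q})

/-- The 2-form `ω₁ = j₁^* ω_Q` on `M₁`. -/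
def omega₁ (L : TQ E Q → ℝ) [ChartedSpace E₁ (M₁ L)] : TwoForm 𝓘(ℝ, E₁) (M := M₁ L) :=
  pullback (j₁ L) omegaQ

/-- The subsets of `TQ` produced by the constraint algorithm for `i_ξ ω_L = dE_L`; the subset with
index `l` is usually denoted by `P_{l+1}`, since `TQ = P_1`. -/
def P (L : TQ E Q → ℝ) (l : ℕ) : Set (TQ E Q) :=
  constraintSet (omegaL L) (differential (energy L)) l

/-- The subsets of `M₁` produced by the constraint algorithm for `i_X ω₁ = dh₁`; the subset with
index `l` is usually denoted by `M_{l+1}`, since the algorithm starts with `M₁`. -/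
def Mset (L : TQ E Q → ℝ) [ChartedSpace E₁ (M₁ L)] (l : ℕ) : Set (M₁ L) :=
  constraintSet (I := 𝓘(ℝ, E₁)) (omega₁ L) (differential (h₁ L)) l

end Lagrangian

end SingularLagrangian

end

open SingularLagrangian

/-! `FL₁` is a surjective submersion with ω_L = FL₁^*ω₁ and dE_L = FL₁^*dh₁. Since each T FL₁ is
onto, v solves the upper equation exactly when T FL₁(v) solves the lower one (`contraction_eq_iff`);
both claims about vector fields are this pointwise equivalence. Curves descend by composition with
`FL₁` and lift by local sections, so tangency to a preimage also transfers, and induction gives P_l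
= FL₁⁻¹(M_l) (`constraintSet_pullback`). Surjectivity then yields the images and the stabilization.

The two pull-back identities carry the geometry. For the form, θ_Q is tautological, so FL^*θ_Q =
α_L, and d commutes with pull-backs (`extDer_pullback`). For the energy, a curve in a fibre of FL
has constant base point and constant covector p, so E_L = p(γ) - L(q, γ) has derivative p(γ') -
p(γ') = 0; connectedness of the fibres makes E_L descend to `h₁`, which is differentiable because it
is locally E_L composed with a section. -/

namespace SingularLagrangian

/-! ### Naturality of the exterior derivative, in charts -/

section ExteriorDerivative

variable {F : Type*} [NormedAddCommGroup F] [NormedSpace ℝ F]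
  {H : Type*} [TopologicalSpace H] {I : ModelWithCorners ℝ F H} [I.Boundaryless]
  {M : Type*} [TopologicalSpace M] [ChartedSpace H M] [IsManifold I ∞ M]
  {F' : Type*} [NormedAddCommGroup F'] [NormedSpace ℝ F']
  {H' : Type*} [TopologicalSpace H'] {J : ModelWithCorners ℝ F' H'} [J.Boundaryless]
  {N : Type*} [TopologicalSpace N] [ChartedSpace H' N] [IsManifold J ∞ N]

/-- The skew-symmetrized derivative of `y ↦ B (f y) ∘ f' y` is the pull-back of the
skew-symmetrized derivative of `B`. -/
theorem fderiv_pullback_sub_flip {B : F' → F' →L[ℝ] ℝ} {f : F → F'} {y : F}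
    (hf : ContDiffAt ℝ 2 f y) (hB : DifferentiableAt ℝ B (f y)) (u v : F) :
    fderiv ℝ (fun z => (B (f z)).comp (fderiv ℝ f z)) y u v
        - fderiv ℝ (fun z => (B (f z)).comp (fderiv ℝ f z)) y v u
      = fderiv ℝ B (f y) (fderiv ℝ f y u) (fderiv ℝ f y v)
        - fderiv ℝ B (f y) (fderiv ℝ f y v) (fderiv ℝ f y u) := by
  have h₁ : HasFDerivAt f (fderiv ℝ f y) y := (hf.differentiableAt (by simp)).hasFDerivAt
  have h₂ : HasFDerivAt (fderiv ℝ f) (fderiv ℝ (fderiv ℝ f) y) y :=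
    ((hf.fderiv_right (m := 1) (by norm_num)).differentiableAt (by simp)).hasFDerivAt
  -- The product rule leaves `B (f y)` applied to the second derivative of `f`; by symmetry this
  -- term cancels in the difference.
  have hsymm : IsSymmSndFDerivAt ℝ f y := hf.isSymmSndFDerivAt (by simp)
  have h := (hB.hasFDerivAt.comp y h₁).clm_comp h₂
  have h' := h.fderiv
  simp only [Function.comp_def] at h'
  rw [h']
  simp [hsymm u v]

/-- The 1-form `f^* β` in charts. -/
theorem localRep_pullback_eventuallyEq {f : M → N} (hf : ContMDiff I J ∞ f)
    (β : OneForm J (M := N)) (x : M) :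
    localRep (fun z => (β (f z)).comp (mfderiv I J f z)) x =ᶠ[𝓝 (extChartAt I x x)]
      fun y => (localRep β (f x) (writtenInExtChartAt I J x f y)).comp
        (fderiv ℝ (writtenInExtChartAt I J x f) y) := by
  have hcont : ContinuousAt (fun y => f ((extChartAt I x).symm y)) (extChartAt I x x) := by
    refine ContinuousAt.comp ?_ (continuousAt_extChartAt_symm x)
    exact hf.continuous.continuousAt
  have hsrc : ∀ᶠ y in 𝓝 (extChartAt I x x),
      f ((extChartAt I x).symm y) ∈ (extChartAt J (f x)).source := by
    refine hcont.eventually_mem ((isOpen_extChartAt_source (f x)).mem_nhds ?_)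
    simp
  have htgt : ∀ᶠ y in 𝓝 (extChartAt I x x), y ∈ (extChartAt I x).target :=
    extChartAt_target_mem_nhds x
  -- `eventually_nhds` is needed because derivatives at `y` are compared: the factorization through
  -- the chart of `N` must hold near `y`, not only at `y`.
  filter_upwards [hsrc.eventually_nhds, htgt] with y hy hyt
  have hys := hy.self_of_nhds
  set ψ := extChartAt J (f x) with hψ
  set φ := extChartAt I x with hφ
  have e₁ : ψ.symm (writtenInExtChartAt I J x f y) = f (φ.symm y) := by
    simp only [writtenInExtChartAt, Function.comp_apply]
    exact ψ.left_inv hys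
  have dφ : MDifferentiableAt 𝓘(ℝ, F) I φ.symm y := by
    have := mdifferentiableWithinAt_extChartAt_symm (I := I) (x := x) hyt
    rwa [I.range_eq_univ, mdifferentiableWithinAt_univ] at this
  have df : MDifferentiableAt I J f (φ.symm y) := (hf.mdifferentiable (by simp)) _
  have dψ : MDifferentiableAt J 𝓘(ℝ, F') ψ (f (φ.symm y)) :=
    mdifferentiableAt_extChartAt (by simpa [hψ] using hys)
  have dψ' : MDifferentiableAt 𝓘(ℝ, F') J ψ.symm (writtenInExtChartAt I J x f y) := by
    have := mdifferentiableWithinAt_extChartAt_symm (I := J) (x := f x)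
      (ψ.map_source hys)
    rwa [J.range_eq_univ, mdifferentiableWithinAt_univ] at this
  have dw : MDifferentiableAt 𝓘(ℝ, F) 𝓘(ℝ, F') (writtenInExtChartAt I J x f) y :=
    dψ.comp y (df.comp y dφ)
  have hev : (fun z => f (φ.symm z)) =ᶠ[𝓝 y] fun z => ψ.symm (writtenInExtChartAt I J x f z) := by
    filter_upwards [hy] with z hz
    exact (ψ.left_inv hz).symm
  have h₁ : mfderiv 𝓘(ℝ, F) J (f ∘ φ.symm) y = (mfderiv I J f (φ.symm y)).comp
      (mfderiv 𝓘(ℝ, F) I φ.symm y) := mfderiv_comp y df dφ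
  have h₂ : mfderiv 𝓘(ℝ, F) J (ψ.symm ∘ writtenInExtChartAt I J x f) y =
      (mfderiv 𝓘(ℝ, F') J ψ.symm (writtenInExtChartAt I J x f y)).comp
      (mfderiv 𝓘(ℝ, F) 𝓘(ℝ, F') (writtenInExtChartAt I J x f) y) := mfderiv_comp y dψ' dw
  have h₃ : (mfderiv 𝓘(ℝ, F) J (f ∘ φ.symm) y : F →L[ℝ] F') =
      mfderiv 𝓘(ℝ, F) J (ψ.symm ∘ writtenInExtChartAt I J x f) y := hev.mfderiv_eq
  have h₄ : (β (ψ.symm (writtenInExtChartAt I J x f y)) : F' →L[ℝ] ℝ) = β (f (φ.symm y)) := by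
    rw [e₁]
  rw [mfderiv_eq_fderiv] at h₂
  have h₅ : ∀ u : F, (mfderiv I J f (φ.symm y) : F →L[ℝ] F')
      ((mfderiv 𝓘(ℝ, F) I φ.symm y : F →L[ℝ] F) u) =
      (mfderiv 𝓘(ℝ, F') J ψ.symm (writtenInExtChartAt I J x f y) : F' →L[ℝ] F')
        (fderiv ℝ (writtenInExtChartAt I J x f) y u) :=
    fun u => DFunLike.congr_fun (h₁.symm.trans (h₃.trans h₂)) u
  exact ContinuousLinearMap.ext fun u =>
    (congrArg (β (f (φ.symm y)) : F' →L[ℝ] ℝ) (h₅ u)).trans (DFunLike.congr_fun h₄.symm _)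

/-- The exterior derivative commutes with pull-backs. -/
theorem extDer_pullback {f : M → N} (hf : ContMDiff I J ∞ f) (β : OneForm J (M := N)) (x : M)
    (hβ : DifferentiableAt ℝ (localRep β (f x)) (extChartAt J (f x) (f x))) :
    extDer (fun z => (β (f z)).comp (mfderiv I J f z)) x = pullback f (extDer β) x := by
  have hw : ContDiffAt ℝ 2 (writtenInExtChartAt I J x f) (extChartAt I x x) := by
    have := (contMDiffAt_iff.1 (hf x)).2
    rw [I.range_eq_univ, contDiffWithinAt_univ] at this
    exact this.of_le (ENat.LEInfty.out)
  have hx : writtenInExtChartAt I J x f (extChartAt I x x) = extChartAt J (f x) (f x) := by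
    simp [writtenInExtChartAt]
  -- At the centres of the preferred charts, the identifications of tangent spaces used by `mfderiv`
  -- and by `extDer` agree.
  have hd : (mfderiv I J f x : F →L[ℝ] F') =
      fderiv ℝ (writtenInExtChartAt I J x f) (extChartAt I x x) := by
    refine (hf.mdifferentiable (by simp) x).mfderiv.trans ?_
    rw [I.range_eq_univ, fderivWithin_univ]
  have key : ∀ u v : F, (extDer (fun z => (β (f z)).comp (mfderiv I J f z)) x :
      F →L[ℝ] F →L[ℝ] ℝ) u v = (extDer β (f x) : F' →L[ℝ] F' →L[ℝ] ℝ)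
        ((mfderiv I J f x : F →L[ℝ] F') u) ((mfderiv I J f x : F →L[ℝ] F') v) := by
    intro u v
    have h := fderiv_pullback_sub_flip hw (by rw [hx]; exact hβ) u v
    rw [hx, ← (localRep_pullback_eventuallyEq hf β x).fderiv_eq, ← hd] at h
    exact h
  exact ContinuousLinearMap.ext fun u => ContinuousLinearMap.ext fun v => key u v

end ExteriorDerivative

/-! ### Canonical coordinates of T^*Q and the pull-back of ω_Q -/

section Cotangent

variable {E : Type*} [NormedAddCommGroup E] [NormedSpace ℝ E]
  {Q : Type*} [TopologicalSpace Q] [ChartedSpace E Q] [IsManifold 𝓘(ℝ, E) ∞ Q]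

theorem extChartAt_symm_cotangent_proj (p : CTQ E Q) {y : E × (E →L[ℝ] ℝ)}
    (hy : y ∈ (extChartAt (cotangentModel E) p).target) :
    ((extChartAt (cotangentModel E) p).symm y).proj = (extChartAt 𝓘(ℝ, E) p.proj).symm y.1 := by
  rw [FiberBundle.extChartAt_target] at hy
  rw [FiberBundle.extChartAt]
  exact (trivializationAt (E →L[ℝ] ℝ)
    (fun q : Q => TangentSpace 𝓘(ℝ, E) q →L[ℝ] Trivial Q ℝ q) p.proj).proj_symm_apply' hy.1.2

/-- The hom-bundle trivialization evaluates a covector on the frame given by the tangent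
trivialization, and that frame is the derivative of the inverse chart of `Q`. Hence the fibre
coordinates are the canonical momenta. -/
theorem extChartAt_symm_cotangent_snd (p : CTQ E Q) {y : E × (E →L[ℝ] ℝ)}
    (hy : y ∈ (extChartAt (cotangentModel E) p).target) (u : E) :
    (((extChartAt (cotangentModel E) p).symm y).2 : E →L[ℝ] ℝ)
      ((mfderiv 𝓘(ℝ, E) 𝓘(ℝ, E) (extChartAt 𝓘(ℝ, E) p.proj).symm y.1 : E →L[ℝ] E) u) = y.2 u := by
  have hproj := extChartAt_symm_cotangent_proj p hy
  set z := (extChartAt (cotangentModel E) p).symm y with hz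
  have hr : extChartAt (cotangentModel E) p z = y := (extChartAt (cotangentModel E) p).right_inv hy
  rw [FiberBundle.extChartAt] at hr
  have h₂ : (trivializationAt (E →L[ℝ] ℝ)
    (fun q : Q => TangentSpace 𝓘(ℝ, E) q →L[ℝ] Trivial Q ℝ q) p.proj z).2 = y.2 := congrArg Prod.snd hr
  have h₁ : extChartAt 𝓘(ℝ, E) p.proj z.proj = y.1 := by
    rw [FiberBundle.extChartAt_target] at hy
    rw [hproj]
    exact (extChartAt 𝓘(ℝ, E) p.proj).right_inv hy.1.1
  have hzs : z.proj ∈ (chartAt E p.proj).source := by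
    rw [FiberBundle.extChartAt_target] at hy
    rw [hproj]
    exact hy.1.2.1
  have hT := TangentBundle.symmL_trivializationAt (I := 𝓘(ℝ, E)) hzs
  rw [h₁] at hT
  simp only [modelWithCornersSelf_coe, range_id, mfderivWithin_univ] at hT
  rw [hom_trivializationAt_apply] at h₂
  have h₃ := DFunLike.congr_fun h₂ u
  have h₄ := DFunLike.congr_fun hT u
  refine Eq.trans (congrArg (z.2 : E →L[ℝ] ℝ) h₄.symm) (Eq.trans ?_ h₃)
  have h₅ : (trivializationAt ℝ (Trivial Q ℝ) p.proj).continuousLinearMapAt ℝ z.proj =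
      ContinuousLinearMap.id ℝ ℝ := Trivial.continuousLinearMapAt_trivialization ℝ Q ℝ z.proj
  exact (DFunLike.congr_fun h₅ _).symm

/-- In the canonical coordinates `θ_Q = p_A dq^A`. -/
theorem localRep_thetaQ_eqOn (p : CTQ E Q) :
    EqOn (localRep (thetaQ (E := E) (Q := Q)) p)
      (fun y => y.2.comp (ContinuousLinearMap.fst ℝ E (E →L[ℝ] ℝ)))
      (extChartAt (cotangentModel E) p).target := by
  intro y hy
  have dχ : MDifferentiableAt 𝓘(ℝ, E × (E →L[ℝ] ℝ)) (cotangentModel E)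
      (extChartAt (cotangentModel E) p).symm y := by
    have := mdifferentiableWithinAt_extChartAt_symm (I := cotangentModel E) (x := p) hy
    rwa [(cotangentModel E).range_eq_univ, mdifferentiableWithinAt_univ] at this
  have dπ : MDifferentiableAt (cotangentModel E) 𝓘(ℝ, E) (fun p : CTQ E Q => p.proj)
      ((extChartAt (cotangentModel E) p).symm y) :=
    (contMDiff_proj (n := ∞) (fun q : Q => TangentSpace 𝓘(ℝ, E) q →L[ℝ] Trivial Q ℝ q)
      _).mdifferentiableAt (by simp)
  have hyt := hy
  rw [FiberBundle.extChartAt_target] at hyt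
  have dφ : MDifferentiableAt 𝓘(ℝ, E) 𝓘(ℝ, E) (extChartAt 𝓘(ℝ, E) p.proj).symm y.1 := by
    have := mdifferentiableWithinAt_extChartAt_symm (I := 𝓘(ℝ, E)) (x := p.proj) hyt.1.1
    rwa [𝓘(ℝ, E).range_eq_univ, mdifferentiableWithinAt_univ] at this
  have dfst : MDifferentiableAt 𝓘(ℝ, E × (E →L[ℝ] ℝ)) 𝓘(ℝ, E) Prod.fst y :=
    differentiableAt_fst.mdifferentiableAt
  have hev : ((fun p : CTQ E Q => p.proj) ∘ (extChartAt (cotangentModel E) p).symm) =ᶠ[𝓝 y]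
      ((extChartAt 𝓘(ℝ, E) p.proj).symm ∘ Prod.fst) := by
    filter_upwards [(isOpen_extChartAt_target p).mem_nhds hy] with z hz
    exact extChartAt_symm_cotangent_proj p hz
  have h₁ := mfderiv_comp y dπ dχ
  have h₂ := mfderiv_comp y dφ dfst
  have h₃ : (mfderiv 𝓘(ℝ, E × (E →L[ℝ] ℝ)) 𝓘(ℝ, E)
      ((fun p : CTQ E Q => p.proj) ∘ (extChartAt (cotangentModel E) p).symm) y :
        E × (E →L[ℝ] ℝ) →L[ℝ] E) = mfderiv 𝓘(ℝ, E × (E →L[ℝ] ℝ)) 𝓘(ℝ, E)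
      ((extChartAt 𝓘(ℝ, E) p.proj).symm ∘ Prod.fst) y := hev.mfderiv_eq
  rw [mfderiv_eq_fderiv, fderiv_fst] at h₂
  refine ContinuousLinearMap.ext fun w => ?_
  refine Eq.trans ?_ (extChartAt_symm_cotangent_snd p hy w.1)
  exact congrArg (((extChartAt (cotangentModel E) p).symm y).2 : E →L[ℝ] ℝ)
    (DFunLike.congr_fun (h₁.symm.trans (h₃.trans h₂)) w)

theorem differentiableAt_localRep_thetaQ (p : CTQ E Q) :
    DifferentiableAt ℝ (localRep (thetaQ (E := E) (Q := Q)) p)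
      (extChartAt (cotangentModel E) p p) := by
  have h : DifferentiableAt ℝ (fun y : E × (E →L[ℝ] ℝ) =>
      y.2.comp (ContinuousLinearMap.fst ℝ E (E →L[ℝ] ℝ))) (extChartAt (cotangentModel E) p p) := by
    fun_prop
  exact h.congr_of_eventuallyEq
    ((localRep_thetaQ_eqOn p).eventuallyEq_of_mem (extChartAt_target_mem_nhds p))

/-- The Legendre transformation pulls back `ω_Q` to `ω_L`. -/
theorem omegaL_apply {L : TQ E Q → ℝ}
    (hL : ContMDiff 𝓘(ℝ, E).tangent (cotangentModel E) ∞ (legendre L)) (v : TQ E Q)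
    (u w : TangentSpace 𝓘(ℝ, E).tangent v) :
    omegaL L v u w = omegaQ (legendre L v)
      (mfderiv 𝓘(ℝ, E).tangent (cotangentModel E) (legendre L) v u)
      (mfderiv 𝓘(ℝ, E).tangent (cotangentModel E) (legendre L) v w) := by
  -- This is the chain rule for π_Q ∘ FL = τ_Q, an equality that holds by definition.
  have hα : alphaL L = fun z => (thetaQ (legendre L z)).comp
      (mfderiv 𝓘(ℝ, E).tangent (cotangentModel E) (legendre L) z) := by
    funext z
    have dπ : MDifferentiableAt (cotangentModel E) 𝓘(ℝ, E) (fun p : CTQ E Q => p.proj)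
        (legendre L z) :=
      (contMDiff_proj (n := ∞) (fun q : Q => TangentSpace 𝓘(ℝ, E) q →L[ℝ] Trivial Q ℝ q)
        _).mdifferentiableAt (by simp)
    have h := mfderiv_comp z dπ (hL.mdifferentiable (by simp) z)
    refine ContinuousLinearMap.ext fun w => ?_
    exact congrArg ((legendre L z).2 : E →L[ℝ] ℝ) (DFunLike.congr_fun h w)
  have h := extDer_pullback hL thetaQ v (differentiableAt_localRep_thetaQ _)
  rw [← hα] at h
  exact congrArg Neg.neg (DFunLike.congr_fun (DFunLike.congr_fun h u) w)

end Cotangent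

/-! ### Local sections of submersions and functions constant on fibres -/

section Submersion

variable {F : Type*} [NormedAddCommGroup F] [NormedSpace ℝ F]
  {H : Type*} [TopologicalSpace H] {I : ModelWithCorners ℝ F H} [I.Boundaryless]
  {M : Type*} [TopologicalSpace M] [ChartedSpace H M]
  {F' : Type*} [NormedAddCommGroup F'] [NormedSpace ℝ F']
  {H' : Type*} [TopologicalSpace H'] {J : ModelWithCorners ℝ F' H'}
  {N : Type*} [TopologicalSpace N] [ChartedSpace H' N]

theorem contMDiffAt_extend_symm {φ : OpenPartialHomeomorph M H}
    (hφ : φ ∈ IsManifold.maximalAtlas I ∞ M) {y : F} (hy : y ∈ (φ.extend I).target) :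
    ContMDiffAt 𝓘(ℝ, F) I ∞ (φ.extend I).symm y := by
  have h := contMDiffOn_extend_symm (I := I) hφ
  rw [← φ.extend_target'] at h
  exact (h y hy).contMDiffAt ((φ.isOpen_extend_target).mem_nhds hy)

/-- Through each point there is a local section of a submersion. -/
theorem exists_localSection {f : M → N} (hf : IsSubmersion I J ∞ f) (x : M) :
    ∃ σ : N → M, ContMDiffAt J I ∞ σ (f x) ∧ σ (f x) = x ∧ ∀ᶠ y in 𝓝 (f x), f (σ y) = y := by
  obtain ⟨K, _, _, hK⟩ := hf
  have h := hK x
  set φ := h.domChart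
  set ψ := h.codChart
  set e := h.equiv
  have hxs : x ∈ (φ.extend I).source := by
    rw [φ.extend_source]; exact h.mem_domChart_source
  have hys : f x ∈ (ψ.extend J).source := by
    rw [ψ.extend_source]; exact h.mem_codChart_source
  have hloc : ∀ z ∈ (φ.extend I).target,
      ψ.extend J (f ((φ.extend I).symm z)) = (e z).1 := fun z hz => h.writtenInCharts hz
  have hx₁ : ψ.extend J (f x) = (e (φ.extend I x)).1 := by
    rw [← hloc _ ((φ.extend I).map_source hxs), (φ.extend I).left_inv hxs]
  -- In the adapted charts `f` is the first projection; the section freezes the second component at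
  -- its value for `x`.
  set τ : N → F := fun y => e.symm (ψ.extend J y, (e (φ.extend I x)).2) with hτ
  have hτx : τ (f x) = φ.extend I x := by
    simp only [hτ, hx₁, Prod.mk.eta, ContinuousLinearEquiv.symm_apply_apply]
  have hτs : ContMDiffAt J 𝓘(ℝ, F) ∞ τ (f x) := by
    have h₁ : ContMDiffAt J 𝓘(ℝ, F') ∞ (ψ.extend J) (f x) :=
      J.contMDiff.contMDiffAt.comp (f x)
        ((contMDiffOn_of_mem_maximalAtlas h.codChart_mem_maximalAtlas).contMDiffAt
          (ψ.open_source.mem_nhds h.mem_codChart_source))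
    have h₂ : ContDiff ℝ ∞ (fun a : F' => e.symm (a, (e (φ.extend I x)).2)) :=
      e.symm.contDiff.comp (contDiff_id.prodMk contDiff_const)
    exact h₂.contMDiff.contMDiffAt.comp (f x) h₁
  have htgt : φ.extend I x ∈ (φ.extend I).target := (φ.extend I).map_source hxs
  refine ⟨fun y => (φ.extend I).symm (τ y), ?_, ?_, ?_⟩
  · refine ContMDiffAt.comp (f x) ?_ hτs
    rw [hτx]
    exact contMDiffAt_extend_symm h.domChart_mem_maximalAtlas htgt
  · simp only [hτx]
    exact (φ.extend I).left_inv hxs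
  · have h₁ : ∀ᶠ y in 𝓝 (f x), τ y ∈ (φ.extend I).target := by
      refine hτs.continuousAt.eventually_mem ?_
      rw [hτx]
      exact φ.isOpen_extend_target.mem_nhds htgt
    have h₂ : ∀ᶠ y in 𝓝 (f x), y ∈ ψ.source :=
      ψ.open_source.mem_nhds h.mem_codChart_source
    filter_upwards [h₁, h₂] with y hy₁ hy₂
    refine (ψ.extend J).injOn ?_ ?_ ?_
    · rw [ψ.extend_source]
      refine h.source_subset_preimage_source ?_
      have := (φ.extend I).map_target hy₁
      rwa [φ.extend_source] at this
    · rwa [ψ.extend_source]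
    · rw [hloc _ hy₁]
      simp only [hτ, ContinuousLinearEquiv.apply_symm_apply]

/-- A function is constant on the connected fibres of a submersion if its derivative along each
curve contained in a fibre vanishes. -/
theorem eq_of_hasDerivAt_zero_of_fiber {f : M → N} (hf : IsSubmersion I J ∞ f)
    (hconn : ∀ q, IsPreconnected (f ⁻¹' {q})) {g : M → ℝ}
    (hg : ∀ (c : ℝ → M) (t : ℝ), ContMDiffAt 𝓘(ℝ, ℝ) I ∞ c t →
      (∀ᶠ s in 𝓝 t, f (c s) = f (c t)) → HasDerivAt (fun s => g (c s)) 0 t)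
    {x y : M} (hxy : f x = f y) : g x = g y := by
  -- Connectedness reduces the claim to nearby points of the same fibre.
  refine (hconn (f y)).induction₂ (fun a b => g a = g b) ?_ (fun _ _ _ _ _ _ h₁ h₂ => h₁.trans h₂)
    (fun _ _ _ _ h => h.symm) hxy rfl
  intro x hx
  obtain ⟨K, _, _, hK⟩ := hf
  have h := hK x
  set φ := h.domChart
  set ψ := h.codChart
  set e := h.equiv
  have hxs : x ∈ (φ.extend I).source := by
    rw [φ.extend_source]; exact h.mem_domChart_source
  have hloc : ∀ z ∈ (φ.extend I).target,
      ψ.extend J (f ((φ.extend I).symm z)) = (e z).1 := fun z hz => h.writtenInCharts hz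
  have htgt : φ.extend I x ∈ (φ.extend I).target := (φ.extend I).map_source hxs
  obtain ⟨r, hr, hball⟩ := Metric.isOpen_iff.1 φ.isOpen_extend_target _ htgt
  have hnear : ∀ᶠ z in 𝓝 x, z ∈ φ.source ∧ φ.extend I z ∈ Metric.ball (φ.extend I x) r :=
    (φ.open_source.eventually_mem h.mem_domChart_source).and
      ((φ.continuousAt_extend h.mem_domChart_source).eventually_mem (Metric.ball_mem_nhds _ hr))
  refine (hnear.filter_mono nhdsWithin_le_nhds).mp ?_
  filter_upwards [self_mem_nhdsWithin] with z hzy ⟨hzs, hzb⟩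
  have hzs' : z ∈ (φ.extend I).source := by rwa [φ.extend_source]
  have hfxz : f x = f z := (mem_singleton_iff.1 hx).trans (mem_singleton_iff.1 hzy).symm
  set a := φ.extend I x
  set b := φ.extend I z
  -- The segment joins two points with equal first component under `e`, so it stays in the fibre;
  -- convexity of the ball keeps it in the chart.
  set ℓ : ℝ → F := fun t => a + t • (b - a) with hℓ
  have hℓt : ∀ t ∈ Icc (0 : ℝ) 1, ℓ t ∈ (φ.extend I).target := fun t ht =>
    hball ((convex_ball a r).add_smul_sub_mem (Metric.mem_ball_self hr) hzb ht)
  have hab : (e a).1 = (e b).1 := by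
    rw [← hloc _ htgt, ← hloc _ ((φ.extend I).map_source hzs'), (φ.extend I).left_inv hxs,
      (φ.extend I).left_inv hzs', hfxz]
  have heℓ : ∀ t, (e (ℓ t)).1 = (e a).1 := fun t => by
    simp [hℓ, hab]
  have hℓs : ContDiff ℝ ∞ ℓ := by fun_prop
  set c : ℝ → M := fun t => (φ.extend I).symm (ℓ t) with hc
  have hder : ∀ t ∈ Icc (0 : ℝ) 1, HasDerivAt (fun s => g (c s)) 0 t := by
    intro t ht
    refine hg c t ?_ ?_
    · exact (contMDiffAt_extend_symm h.domChart_mem_maximalAtlas (hℓt t ht)).comp t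
        hℓs.contMDiff.contMDiffAt
    · have hfs : ∀ s, ℓ s ∈ (φ.extend I).target → f (c s) ∈ (ψ.extend J).source := fun s hs => by
        rw [ψ.extend_source]
        refine h.source_subset_preimage_source ?_
        have := (φ.extend I).map_target hs
        rwa [φ.extend_source] at this
      filter_upwards [hℓs.continuous.continuousAt.eventually_mem
        (φ.isOpen_extend_target.mem_nhds (hℓt t ht))] with s hs
      refine (ψ.extend J).injOn (hfs s hs) (hfs t (hℓt t ht)) ?_
      rw [hloc _ hs, hloc _ (hℓt t ht), heℓ, heℓ]
  have hconst := constant_of_derivWithin_zero (f := fun s => g (c s)) (a := 0) (b := 1)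
    (fun t ht => (hder t ht).differentiableAt.differentiableWithinAt)
    (fun t ht => ((hder t ⟨ht.1, ht.2.le⟩).hasDerivWithinAt).derivWithin
      (uniqueDiffOn_Icc zero_lt_one t ⟨ht.1, ht.2.le⟩)) 1 (by simp)
  have hc0 : c 0 = x := by
    simp only [hc, hℓ, zero_smul, add_zero]
    exact (φ.extend I).left_inv hxs
  have hc1 : c 1 = z := by
    simp only [hc, hℓ, one_smul, add_sub_cancel]
    exact (φ.extend I).left_inv hzs'
  simp only [hc0, hc1] at hconst
  exact hconst.symm

end Submersion

/-! ### The energy along the fibres of FL -/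

section Energy

variable {E : Type*} [NormedAddCommGroup E] [NormedSpace ℝ E]
  {Q : Type*} [TopologicalSpace Q] [ChartedSpace E Q] [IsManifold 𝓘(ℝ, E) ∞ Q]

/-- `E_L(v) = ⟨FL(v), v⟩ - L(v)`. -/
theorem energy_eq (L : TQ E Q → ℝ) (v : TQ E Q) :
    energy L v = ((legendre L v).2 : E →L[ℝ] ℝ) v.2 - L v := rfl

theorem contMDiff_energy {L : TQ E Q → ℝ} (hL : ContMDiff 𝓘(ℝ, E).tangent 𝓘(ℝ, ℝ) ∞ L)
    (hFL : ContMDiff 𝓘(ℝ, E).tangent (cotangentModel E) ∞ (legendre L)) :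
    ContMDiff 𝓘(ℝ, E).tangent 𝓘(ℝ, ℝ) ∞ (energy L) := by
  intro v
  have h : ContMDiffAt 𝓘(ℝ, E).tangent (𝓘(ℝ, E).prod 𝓘(ℝ, ℝ)) ∞
      (fun v : TQ E Q => TotalSpace.mk' ℝ (E := Trivial Q ℝ) v.proj ((legendre L v).2 v.2)) v :=
    ContMDiffAt.clm_bundle_apply (E₁ := fun q : Q => TangentSpace 𝓘(ℝ, E) q)
      (hFL v) contMDiffAt_id
  exact (contMDiffAt_totalSpace.1 h).2.sub (hL v)

/-- Over its own centre the trivialization is the identity, so a curve in one fibre T_qQ can be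
differentiated as a curve in `E`. -/
theorem trivializationAt_self_snd (q : Q) (w : E) :
    (trivializationAt E (TangentSpace 𝓘(ℝ, E)) q (⟨q, w⟩ : TQ E Q)).2 = w := by
  exact (tangentBundleCore 𝓘(ℝ, E) Q).coordChange_self (achart E q) q (mem_chart_source E q) w

theorem contMDiff_fibre_inclusion (q : Q) :
    ContMDiff 𝓘(ℝ, E) 𝓘(ℝ, E).tangent ∞ (fun w : E => (⟨q, w⟩ : TQ E Q)) := by
  intro w
  rw [contMDiffAt_totalSpace]
  refine ⟨contMDiffAt_const, ?_⟩
  simp only [trivializationAt_self_snd]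
  exact contMDiffAt_id

/-- The Legendre transformation is the derivative of `L` along the fibres of `TQ`. -/
theorem hasFDerivAt_fibre {L : TQ E Q → ℝ} (hL : ContMDiff 𝓘(ℝ, E).tangent 𝓘(ℝ, ℝ) ∞ L)
    (q : Q) (w : E) :
    HasFDerivAt (fun w : E => L ⟨q, w⟩) ((legendre L ⟨q, w⟩).2 : E →L[ℝ] ℝ) w := by
  have h₁ := (hL.mdifferentiable (by simp) (⟨q, w⟩ : TQ E Q)).hasMFDerivAt
  have h₂ := ((contMDiff_fibre_inclusion q).mdifferentiable (by simp) w).hasMFDerivAt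
  exact (HasMFDerivAt.comp w h₁ h₂).hasFDerivAt

/-- The derivative of the energy vanishes along the curves contained in a fibre of the Legendre
transformation. -/
theorem hasDerivAt_energy_of_legendre_const {L : TQ E Q → ℝ}
    (hL : ContMDiff 𝓘(ℝ, E).tangent 𝓘(ℝ, ℝ) ∞ L) {c : ℝ → TQ E Q} {t : ℝ}
    (hc : ContMDiffAt 𝓘(ℝ, ℝ) 𝓘(ℝ, E).tangent ∞ c t)
    (hconst : ∀ᶠ s in 𝓝 t, legendre L (c s) = legendre L (c t)) :
    HasDerivAt (fun s => energy L (c s)) 0 t := by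
  set q : Q := (c t).proj with hq
  set p : E →L[ℝ] ℝ := (legendre L (c t)).2 with hp
  set γ : ℝ → E := fun s => (c s).2 with hγ
  have hproj : ∀ᶠ s in 𝓝 t, (c s).proj = q := by
    filter_upwards [hconst] with s hs using congrArg (fun p : CTQ E Q => p.proj) hs
  have hcγ : ∀ᶠ s in 𝓝 t, c s = ⟨q, γ s⟩ := by
    filter_upwards [hproj] with s hs
    rw [← hs]
  have hγd : DifferentiableAt ℝ γ t := by
    have h := ((contMDiffAt_totalSpace.1 hc).2.contDiffAt.differentiableAt (by simp))
    refine h.congr_of_eventuallyEq ?_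
    filter_upwards [hcγ] with s hs
    rw [hs, trivializationAt_self_snd]
  have hE : (fun s => energy L (c s)) =ᶠ[𝓝 t] fun s => p (γ s) - L ⟨q, γ s⟩ := by
    filter_upwards [hconst, hcγ] with s hs hs'
    rw [energy_eq, hs, ← hs']
    rfl
  have hd := (hasFDerivAt_fibre hL q (γ t)).comp_hasDerivAt t hγd.hasDerivAt
  have h := (p.hasFDerivAt.comp_hasDerivAt t hγd.hasDerivAt).sub hd
  refine HasDerivAt.congr_of_eventuallyEq ?_ hE
  refine h.congr_deriv ?_
  -- `c t` is definitionally `⟨q, γ t⟩`, so the fibre derivative of `L` there is `p` itself.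
  exact sub_self _

end Energy

/-! ### Transfer of the constraint algorithm along a submersion -/

section Projection

variable {F : Type*} [NormedAddCommGroup F] [NormedSpace ℝ F]
  {H : Type*} [TopologicalSpace H] {I : ModelWithCorners ℝ F H}
  {M : Type*} [TopologicalSpace M] [ChartedSpace H M]
  {F' : Type*} [NormedAddCommGroup F'] [NormedSpace ℝ F']
  {H' : Type*} [TopologicalSpace H'] {J : ModelWithCorners ℝ F' H'}
  {N : Type*} [TopologicalSpace N] [ChartedSpace H' N]

/-- The derivative of a local section of `f` is a right inverse of the derivative of `f`. -/
theorem mfderiv_mfderiv_of_localSection {f : M → N} {x : M} {σ : N → M}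
    (hf : MDifferentiableAt I J f x) (hσ : MDifferentiableAt J I σ (f x)) (hσx : σ (f x) = x)
    (hfσ : ∀ᶠ y in 𝓝 (f x), f (σ y) = y) (u : F') :
    (mfderiv I J f x : F →L[ℝ] F') ((mfderiv J I σ (f x) : F' →L[ℝ] F) u) = u := by
  have h₁ : (mfderiv J J (f ∘ σ) (f x) : F' →L[ℝ] F') =
      ContinuousLinearMap.comp (mfderiv I J f (σ (f x)) : F →L[ℝ] F')
        (mfderiv J I σ (f x) : F' →L[ℝ] F) :=
    mfderiv_comp_of_eq hf hσ hσx
  have h₂ : (mfderiv J J (f ∘ σ) (f x) : F' →L[ℝ] F') = mfderiv J J id (f x) :=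
    Filter.EventuallyEq.mfderiv_eq hfσ
  have h₃ : ∀ z, z = x → (mfderiv I J f z : F →L[ℝ] F') = mfderiv I J f x := by
    rintro _ rfl
    rfl
  rw [h₁, h₃ _ hσx] at h₂
  exact (DFunLike.congr_fun h₂ u).trans (DFunLike.congr_fun (mfderiv_id (I := J) (x := f x)) u)

/-- Tangency is defined by velocities of curves, so it is enough to compose; no submanifold
structure enters. -/
theorem tangentSet_map {f : M → N} {x : M} (hf : ContMDiffAt I J ∞ f x) {S : Set N}
    {v : TangentSpace I x} (hv : (⟨x, v⟩ : TangentBundle I M) ∈ tangentSet I (f ⁻¹' S)) :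
    (⟨f x, mfderiv I J f x v⟩ : TangentBundle J N) ∈ tangentSet J S := by
  obtain ⟨c, hc, hcS, hcv⟩ := hv
  have hx : c 0 = x := congrArg TotalSpace.proj hcv
  have hf' : ContMDiffAt I J ∞ f (c 0) := by rwa [hx]
  refine ⟨f ∘ c, hf'.comp 0 hc, hcS, ?_⟩
  rw [tangentMap_comp_at _ (hf'.mdifferentiableAt (by simp)) (hc.mdifferentiableAt (by simp)), hcv]
  rfl

variable [I.Boundaryless]

theorem mfderiv_surjective_of_isSubmersion {f : M → N} (hf : IsSubmersion I J ∞ f) (x : M) :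
    Function.Surjective (mfderiv I J f x) := by
  obtain ⟨σ, hσ, hσx, hfσ⟩ := exists_localSection hf x
  have hfx := (hf.isSubmersionAt x).contMDiffAt.mdifferentiableAt (by simp)
  exact fun u => ⟨_, mfderiv_mfderiv_of_localSection hfx (hσ.mdifferentiableAt (by simp)) hσx hfσ u⟩

/-- Tangent vectors can be lifted along submersions. -/
theorem tangentSet_lift {f : M → N} (hf : IsSubmersion I J ∞ f) {x : M} {S : Set N}
    {u : TangentSpace J (f x)} (hu : (⟨f x, u⟩ : TangentBundle J N) ∈ tangentSet J S) :
    ∃ v : TangentSpace I x, mfderiv I J f x v = u ∧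
      (⟨x, v⟩ : TangentBundle I M) ∈ tangentSet I (f ⁻¹' S) := by
  obtain ⟨σ, hσ, hσx, hfσ⟩ := exists_localSection hf x
  have hfx := (hf.isSubmersionAt x).contMDiffAt.mdifferentiableAt (by simp)
  refine ⟨(mfderiv J I σ (f x) : F' →L[ℝ] F) u,
    mfderiv_mfderiv_of_localSection hfx (hσ.mdifferentiableAt (by simp)) hσx hfσ u, ?_⟩
  obtain ⟨d, hd, hdS, hdu⟩ := hu
  have hd0 : d 0 = f x := congrArg TotalSpace.proj hdu
  have hσ' : ContMDiffAt J I ∞ σ (d 0) := by rwa [hd0]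
  -- The lifted curve lies in the preimage because `f ∘ σ ∘ d` agrees with `d` near `0`.
  refine ⟨σ ∘ d, hσ'.comp 0 hd, ?_, ?_⟩
  · rw [← hd0] at hfσ
    filter_upwards [hdS, hd.continuousAt.eventually hfσ] with t ht ht'
    change f (σ (d t)) ∈ S
    rwa [ht']
  · rw [tangentMap_comp_at _ (hσ'.mdifferentiableAt (by simp)) (hd.mdifferentiableAt (by simp)),
      hdu]
    have : ∀ (x' : M) (w : F), x' = x → (⟨x', w⟩ : TangentBundle I M) = ⟨x, w⟩ := by
      rintro _ w rfl
      rfl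
    exact this _ _ hσx

variable {f : M → N} {Ω : TwoForm J (M := N)} {α : OneForm J (M := N)}
  {Ω' : TwoForm I (M := M)} {α' : OneForm I (M := M)}

/-- The equation `i_v (f^* Ω) = f^* α` is equivalent to `i_{Tf(v)} Ω = α`. -/
theorem contraction_eq_iff (hf : IsSubmersion I J ∞ f)
    (hΩ : ∀ x u w, Ω' x u w = Ω (f x) (mfderiv I J f x u) (mfderiv I J f x w))
    (hα : ∀ x w, α' x w = α (f x) (mfderiv I J f x w)) (x : M) (v : TangentSpace I x) :
    Ω' x v = α' x ↔ Ω (f x) (mfderiv I J f x v) = α (f x) := by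
  constructor
  · intro h
    refine ContinuousLinearMap.ext fun u => ?_
    -- Only here is surjectivity of the derivative used: vectors Tf(w) test a form on the whole
    -- tangent space of `N`.
    obtain ⟨w, rfl⟩ := mfderiv_surjective_of_isSubmersion hf x u
    rw [← hΩ, ← hα, h]
  · intro h
    refine ContinuousLinearMap.ext fun w => ?_
    rw [hΩ, hα, h]

/-- The constraint algorithm commutes with pull-backs by submersions. -/
theorem constraintSet_pullback (hf : IsSubmersion I J ∞ f)
    (hΩ : ∀ x u w, Ω' x u w = Ω (f x) (mfderiv I J f x u) (mfderiv I J f x w))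
    (hα : ∀ x w, α' x w = α (f x) (mfderiv I J f x w)) (l : ℕ) :
    constraintSet Ω' α' l = f ⁻¹' constraintSet Ω α l := by
  induction l with
  | zero => rfl
  | succ l ih =>
    ext x
    simp only [constraintSet, mem_ofPred_eq, mem_preimage]
    rw [ih]
    refine and_congr_right fun _ => ⟨?_, ?_⟩
    · rintro ⟨v, hv, hv'⟩
      exact ⟨_, tangentSet_map (hf.isSubmersionAt x).contMDiffAt hv,
        (contraction_eq_iff hf hΩ hα x v).1 hv'⟩
    · rintro ⟨u, hu, hu'⟩
      obtain ⟨v, rfl, hv⟩ := tangentSet_lift hf hu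
      exact ⟨v, hv, (contraction_eq_iff hf hΩ hα x v).2 hu'⟩

end Projection

/-! ### The pull-back identities for FL₁ -/

section AlmostRegular

variable {E : Type*} [NormedAddCommGroup E] [NormedSpace ℝ E]
  {Q : Type*} [TopologicalSpace Q] [ChartedSpace E Q] [IsManifold 𝓘(ℝ, E) ∞ Q]
  {L : TQ E Q → ℝ}
  {E₁ : Type*} [NormedAddCommGroup E₁] [NormedSpace ℝ E₁] [ChartedSpace E₁ (M₁ L)]

/-- FL factors as `j₁ L ∘ FL₁ L`, both smooth by almost regularity; no fibre derivative of `L` has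
to be examined. -/
theorem IsAlmostRegular.contMDiff_legendre (hreg : IsAlmostRegular (E₁ := E₁) L) :
    ContMDiff 𝓘(ℝ, E).tangent (cotangentModel E) ∞ (legendre L) :=
  hreg.isSmoothEmbedding.contMDiff.comp hreg.isSubmersion.contMDiff

/-- The preimage chosen in `h₁` lies in the same fibre as `v`, and the energy is constant on that
fibre. -/
theorem IsAlmostRegular.h₁_FL₁ (hreg : IsAlmostRegular (E₁ := E₁) L)
    (hL : ContMDiff 𝓘(ℝ, E).tangent 𝓘(ℝ, ℝ) ∞ L) (v : TQ E Q) :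
    h₁ L (FL₁ L v) = energy L v := by
  refine eq_of_hasDerivAt_zero_of_fiber hreg.isSubmersion
    (fun q => (hreg.isConnected_fiber q).isPreconnected) (fun c t hc hconst => ?_)
    (Subtype.ext (Classical.choose_spec (FL₁ L v).2))
  refine hasDerivAt_energy_of_legendre_const hL hc ?_
  filter_upwards [hconst] with s hs using congrArg Subtype.val hs

theorem IsAlmostRegular.mdifferentiableAt_h₁ (hreg : IsAlmostRegular (E₁ := E₁) L)
    (hL : ContMDiff 𝓘(ℝ, E).tangent 𝓘(ℝ, ℝ) ∞ L) (v : TQ E Q) :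
    MDifferentiableAt 𝓘(ℝ, E₁) 𝓘(ℝ, ℝ) (h₁ L) (FL₁ L v) := by
  obtain ⟨σ, hσ, -, hfσ⟩ := exists_localSection hreg.isSubmersion v
  have h : ContMDiffAt 𝓘(ℝ, E₁) 𝓘(ℝ, ℝ) ∞ (energy L ∘ σ) (FL₁ L v) :=
    (contMDiff_energy hL hreg.contMDiff_legendre _).comp _ hσ
  refine (h.mdifferentiableAt (by simp)).congr_of_eventuallyEq ?_
  filter_upwards [hfσ] with y hy
  rw [Function.comp_apply, ← hreg.h₁_FL₁ hL, hy]

/-- `dE_L = FL₁^* dh₁`. -/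
theorem IsAlmostRegular.differential_energy (hreg : IsAlmostRegular (E₁ := E₁) L)
    (hL : ContMDiff 𝓘(ℝ, E).tangent 𝓘(ℝ, ℝ) ∞ L) (v : TQ E Q)
    (w : TangentSpace 𝓘(ℝ, E).tangent v) :
    differential (I := 𝓘(ℝ, E).tangent) (energy L) v w =
      differential (I := 𝓘(ℝ, E₁)) (h₁ L) (FL₁ L v)
        (mfderiv 𝓘(ℝ, E).tangent 𝓘(ℝ, E₁) (FL₁ L) v w) := by
  have h : energy L = h₁ L ∘ FL₁ L := funext fun v => (hreg.h₁_FL₁ hL v).symm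
  have hc := mfderiv_comp v (hreg.mdifferentiableAt_h₁ hL v)
    (hreg.isSubmersion.contMDiff.mdifferentiable (by simp) v)
  rw [h]
  exact DFunLike.congr_fun hc w

/-- `ω_L = FL₁^* ω₁`. -/
theorem IsAlmostRegular.omegaL_apply (hreg : IsAlmostRegular (E₁ := E₁) L) (v : TQ E Q)
    (u w : TangentSpace 𝓘(ℝ, E).tangent v) :
    omegaL L v u w = omega₁ (E₁ := E₁) L (FL₁ L v)
        (mfderiv 𝓘(ℝ, E).tangent 𝓘(ℝ, E₁) (FL₁ L) v u)
        (mfderiv 𝓘(ℝ, E).tangent 𝓘(ℝ, E₁) (FL₁ L) v w) := by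
  have hc := mfderiv_comp v (hreg.isSmoothEmbedding.contMDiff.mdifferentiable (by simp) (FL₁ L v))
    (hreg.isSubmersion.contMDiff.mdifferentiable (by simp) v)
  have h : ∀ z : TangentSpace 𝓘(ℝ, E).tangent v,
      mfderiv 𝓘(ℝ, E).tangent (cotangentModel E) (legendre L) v z =
        mfderiv 𝓘(ℝ, E₁) (cotangentModel E) (j₁ L) (FL₁ L v)
          (mfderiv 𝓘(ℝ, E).tangent 𝓘(ℝ, E₁) (FL₁ L) v z) := fun z => DFunLike.congr_fun hc z
  rw [SingularLagrangian.omegaL_apply hreg.contMDiff_legendre, h, h]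
  rfl

end AlmostRegular

end SingularLagrangian

theorem mainTheorem8
    {E : Type*} [NormedAddCommGroup E] [NormedSpace ℝ E] [FiniteDimensional ℝ E]
    {Q : Type*} [TopologicalSpace Q] [ChartedSpace E Q] [IsManifold 𝓘(ℝ, E) ∞ Q]
    (L : TQ E Q → ℝ) (hL : ContMDiff 𝓘(ℝ, E).tangent 𝓘(ℝ, ℝ) ∞ L)
    {E₁ : Type*} [NormedAddCommGroup E₁] [NormedSpace ℝ E₁] [FiniteDimensional ℝ E₁]
    [ChartedSpace E₁ (M₁ L)]
    [IsManifold 𝓘(ℝ, E₁) ∞ (M₁ L)]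
    (hreg : IsAlmostRegular (E₁ := E₁) L)
    (hP : ∀ l, IsSubmanifold 𝓘(ℝ, E).tangent (P L l))
    (hM : ∀ l, IsSubmanifold 𝓘(ℝ, E₁)
      (Mset (E₁ := E₁) L l))
    (k : ℕ) (hk : P L (k + 1) = P L k) :
    -- the algorithm on `M₁` also stabilizes at step `k`, and `FL` maps `P_f` onto `M_f`
    (Mset (E₁ := E₁) L (k + 1) = Mset (E₁ := E₁) L k ∧
      FL₁ L '' P L k
        = Mset (E₁ := E₁) L k) ∧
    -- the projection of a projectable solution is a solution
    (∀ (ξ : ∀ v : TQ E Q, TangentSpace 𝓘(ℝ, E).tangent v)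
        (X : ∀ q : M₁ L, TangentSpace 𝓘(ℝ, E₁) q),
      IsVectorFieldOn (P L k) ξ →
      IsVectorFieldOn (Mset (E₁ := E₁) L k) X →
      ProjectsOn (FL₁ L) (P L k) ξ X →
      IsSolutionOn (omegaL L)
        (differential (energy L))
        (P L k) ξ →
      IsSolutionOn (omega₁ L)
        (differential (h₁ L))
        (Mset (E₁ := E₁) L k) X) ∧
    -- a projectable vector field which projects on a solution is a solution
    (∀ (X : ∀ q : M₁ L, TangentSpace 𝓘(ℝ, E₁) q)
        (ξ : ∀ v : TQ E Q, TangentSpace 𝓘(ℝ, E).tangent v),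
      IsVectorFieldOn (Mset (E₁ := E₁) L k) X →
      IsVectorFieldOn (P L k) ξ →
      ProjectsOn (FL₁ L) (P L k) ξ X →
      IsSolutionOn (omega₁ L)
        (differential (h₁ L))
        (Mset (E₁ := E₁) L k) X →
      IsSolutionOn (omegaL L)
        (differential (energy L))
        (P L k) ξ) := by
  have hsurj : Function.Surjective (FL₁ L) := rangeFactorization_surjective
  have hf := hreg.isSubmersion
  have hΩ := hreg.omegaL_apply
  have hα := hreg.differential_energy hL
  have hpre : ∀ l, P L l = FL₁ L ⁻¹' Mset (E₁ := E₁) L l := constraintSet_pullback hf hΩ hα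
  have himage : ∀ l, FL₁ L '' P L l = Mset (E₁ := E₁) L l := fun l => by
    rw [hpre, image_preimage_eq _ hsurj]
  refine ⟨⟨?_, himage k⟩, ?_, ?_⟩
  -- Each constraint set below is the image of the one above, so stabilization descends.
  · rw [← himage, hk, himage]
  · intro ξ X _ _ hproj hsol q hq
    obtain ⟨v, rfl⟩ := hsurj q
    have hv : v ∈ P L k := by rwa [hpre]
    rw [← hproj v hv]
    exact (contraction_eq_iff hf hΩ hα v (ξ v)).1 (hsol v hv)
  · intro X ξ _ _ hproj hsol v hv
    refine (contraction_eq_iff hf hΩ hα v (ξ v)).2 ?_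
    rw [hproj v hv]
    exact hsol _ (by rwa [hpre] at hv)
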